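/- A $c$-edge-colored multigraph is a finite loopless multigraph each of whose edges has one of $c$ given colors, such that no two parallel edges have the same color. A proper Hamiltonian cycle is a cycle through all the vertices in which any two adjacent edges have different colors. Let $n \ge 4$ and $3 \le c < n$. If $G$ is a $c$-edge-colored multigraph on $n$ vertices with $m \ge c\binom{n-1}{2} + n$ edges (parallel edges counted separately), then $G$ has a proper Hamiltonian cycle. The bound is tight: for all $n \ge 4$ and $3 \le c < n$ there is a connected $c$-edge-colored multigraph on $n$ vertices with exactly $c\binom{n-1}{2} + n - 1$ edges that has no proper Hamiltonian cycle. -/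

import Mathlib

/-- A `c`-edge-colored multigraph with vertex set `V`: there are no loops, every edge carries one
of the `c` colors, and parallel edges have different colors. Hence an edge is determined by its
unordered pair of endpoints together with its color. -/
structure ColoredMultigraph (V : Type*) (c : ℕ) where
  /-- The edges: pairs (unordered pair of endpoints, color). -/
  edges : Finset (Sym2 V × Fin c)
  loopless : ∀ e ∈ edges, ¬ e.1.IsDiag

namespace ColoredMultigraph

/-- The number `m` of edges, where parallel edges are counted separately. -/
def numEdges {V : Type*} {c : ℕ} (G : ColoredMultigraph V c) : ℕ := G.edges.card

/-- The simple graph in which two vertices are adjacent when some edge, of any color, joins them. -/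
def underlying {V : Type*} {c : ℕ} (G : ColoredMultigraph V c) : SimpleGraph V where
  Adj x y := ∃ i : Fin c, (s(x, y), i) ∈ G.edges
  symm := ⟨fun x y ⟨i, hi⟩ => ⟨i, by rwa [Sym2.eq_swap]⟩⟩
  loopless := ⟨fun x ⟨_, hi⟩ => G.loopless _ hi (Sym2.mk_isDiag_iff.mpr rfl)⟩

/-- A multigraph is connected when any two vertices are joined by a path, of whatever colors. -/
def Connected {V : Type*} {c : ℕ} (G : ColoredMultigraph V c) : Prop := G.underlying.Connected

/-- The distinct vertices `v i`, for `i` in `ℤ/k` with `k ≥ 3`, form in this cyclic order a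
properly colored cycle of `G`, which uses between `v i` and `v (i + 1)` the edge of color `col i`.
Two different edges of such a cycle are adjacent exactly when they are cyclically consecutive. -/
structure IsProperCycle {V : Type*} {c : ℕ} (G : ColoredMultigraph V c) {k : ℕ}
    (v : ZMod k → V) (col : ZMod k → Fin c) : Prop where
  three_le : 3 ≤ k
  injective : Function.Injective v
  mem_edges : ∀ i, (s(v i, v (i + 1)), col i) ∈ G.edges
  proper : ∀ i, col i ≠ col (i + 1)

/-- `G` has a proper Hamiltonian cycle: a properly colored cycle through all vertices. -/
def HasProperHamiltonianCycle {V : Type*} {c : ℕ} (G : ColoredMultigraph V c) : Prop :=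
  ∃ (k : ℕ) (v : ZMod k → V) (col : ZMod k → Fin c),
    G.IsProperCycle v col ∧ Function.Surjective v

end ColoredMultigraph

/-! Call a pair bad if it carries at most one color, and let `N` be the number of vertices. The edge
bound says that at most `c(N-1) - N` colors are missing over all pairs. A bad pair misses at least
`c-1`, so there are at most `N-2` bad pairs.

A Hamiltonian cycle of pairs can be properly colored if one pair has three colors, at most one other
has a single color, and the rest have two (`exists_cyclic_list_coloring`). On `n` vertices, `n-3`
forbidden pairs can be avoided by a cyclic order (`exists_isCyclicEnum_notMem`).

With at most `N-4` bad pairs, set aside a vertex `x` with few missing colors, order the others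
avoiding bad pairs, and insert `x` where its two new pairs together miss fewer than `c-1` colors.
With `N-3` or `N-2` bad pairs, order all vertices, tolerating one pair with a single color if
necessary. The bad pairs then use up so many missing colors that some pair on the cycle has three.

For tightness, all edges at one vertex get the same color. -/

/-! ### Cyclic enumerations and insertion -/

/-- `w` lists the elements of `S` periodically, each of them once in every period `n`. -/
structure IsCyclicEnum {V : Type*} (S : Finset V) (n : ℕ) (w : ℕ → V) : Prop where
  eq_iff : ∀ a b, w a = w b ↔ a ≡ b [MOD n]
  mem_iff : ∀ y, y ∈ S ↔ ∃ k, w k = y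

namespace IsCyclicEnum

variable {V : Type*} {S : Finset V} {n : ℕ} {w : ℕ → V}

theorem mem (h : IsCyclicEnum S n w) (k : ℕ) : w k ∈ S := (h.mem_iff _).2 ⟨k, rfl⟩

theorem apply_mod (h : IsCyclicEnum S n w) (k : ℕ) : w (k % n) = w k :=
  (h.eq_iff _ _).2 (Nat.mod_modEq k n)

theorem injOn_lt (h : IsCyclicEnum S n w) {a b : ℕ} (ha : a < n) (hb : b < n)
    (hab : w a = w b) : a = b := by
  have := (h.eq_iff a b).1 hab
  rwa [Nat.ModEq, Nat.mod_eq_of_lt ha, Nat.mod_eq_of_lt hb] at this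

theorem shift (h : IsCyclicEnum S n w) (hn : 0 < n) (j : ℕ) :
    IsCyclicEnum S n (fun k => w (k + j)) where
  eq_iff a b := by
    rw [h.eq_iff]
    exact ⟨Nat.ModEq.add_right_cancel' j, Nat.ModEq.add_right j⟩
  mem_iff y := by
    rw [h.mem_iff]
    constructor
    · rintro ⟨k, rfl⟩
      refine ⟨k + n * j - j, ?_⟩
      have : j ≤ n * j := Nat.le_mul_of_pos_left j hn
      rw [h.eq_iff, show k + n * j - j + j = k + n * j by omega]
      simp [Nat.ModEq]
    · rintro ⟨k, rfl⟩
      exact ⟨_, rfl⟩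

theorem sum_range (h : IsCyclicEnum S n w) (hn : 0 < n) {M : Type*} [AddCommMonoid M]
    (f : V → M) : ∑ k ∈ Finset.range n, f (w k) = ∑ y ∈ S, f y := by
  refine Finset.sum_bij (fun k _ => w k) (fun k _ => h.mem k) ?_ ?_ (fun _ _ => rfl)
  · intro a ha b hb hab
    exact h.injOn_lt (Finset.mem_range.1 ha) (Finset.mem_range.1 hb) hab
  · intro y hy
    obtain ⟨k, rfl⟩ := (h.mem_iff y).1 hy
    exact ⟨k % n, Finset.mem_range.2 (Nat.mod_lt _ hn), h.apply_mod k⟩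

/-- If the weights `f` have small sum, some two cyclically consecutive elements have small
total weight. -/
theorem exists_consecutive_lt (h : IsCyclicEnum S n w) (hn : 0 < n) (f : V → ℕ) {t : ℕ}
    (hf : 2 * ∑ y ∈ S, f y < n * t) : ∃ k, f (w k) + f (w (k + 1)) < t := by
  by_contra! hcon
  have h1 := h.sum_range hn f
  have h2 := (h.shift hn 1).sum_range hn f
  have h3 : ∑ _k ∈ Finset.range n, t ≤ ∑ k ∈ Finset.range n, (f (w k) + f (w (k + 1))) :=
    Finset.sum_le_sum fun k _ => hcon k
  rw [Finset.sum_add_distrib, h1, h2] at h3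
  simp at h3
  omega

/-- A new element can be inserted between any two cyclically consecutive ones. -/
theorem exists_insert [DecidableEq V] (h : IsCyclicEnum S n w) (hn : 0 < n) {x : V}
    (hx : x ∉ S) (j : ℕ) :
    ∃ w', IsCyclicEnum (insert x S) (n + 1) w' ∧
      (∀ k, (∃ i, w' k = w i ∧ w' (k + 1) = w (i + 1)) ∨ (w' k = w j ∧ w' (k + 1) = x) ∨
        (w' k = x ∧ w' (k + 1) = w (j + 1))) ∧
      (∃ k, w' k = w j ∧ w' (k + 1) = x) ∧ (∃ k, w' k = x ∧ w' (k + 1) = w (j + 1)) := by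
  have hs := h.shift hn (j + 1)
  -- Started after `w j`, the period ends in `w j`; so `x` goes at its end, in position `n`.
  set u : ℕ → V := fun k => w (k + (j + 1)) with hu
  have hlast : u (n - 1) = w j := by
    rw [hu, h.eq_iff]
    rw [show n - 1 + (j + 1) = j + n by omega]
    simp [Nat.ModEq]
  have hux : ∀ k, u k ≠ x := fun k hk => hx (hk ▸ hs.mem k)
  let w' : ℕ → V := fun k => if k % (n + 1) = n then x else u (k % (n + 1))
  have hw'n : ∀ k, k % (n + 1) = n → w' k = x := fun k hk => if_pos hk
  have hw'u : ∀ k, k % (n + 1) ≠ n → w' k = u (k % (n + 1)) := fun k hk => if_neg hk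
  have hlt : ∀ k, k % (n + 1) < n + 1 := fun k => Nat.mod_lt _ (Nat.succ_pos n)
  have hsucc : ∀ k, k % (n + 1) ≠ n → (k + 1) % (n + 1) = k % (n + 1) + 1 := by
    intro k hk
    rw [Nat.add_mod, Nat.mod_eq_of_lt (show 1 < n + 1 by omega)]
    exact Nat.mod_eq_of_lt (by have := hlt k; omega)
  have hsucc' : ∀ k, k % (n + 1) = n → (k + 1) % (n + 1) = 0 := by
    intro k hk
    rw [Nat.add_mod, hk, Nat.mod_eq_of_lt (show 1 < n + 1 by omega), Nat.mod_self]
  have hA : ∀ k, k % (n + 1) = n - 1 → w' k = w j ∧ w' (k + 1) = x := by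
    intro k hk
    have hk' : k % (n + 1) ≠ n := by omega
    refine ⟨by rw [hw'u k hk', hk, hlast], hw'n _ ?_⟩
    rw [hsucc k hk']
    omega
  have hB : ∀ k, k % (n + 1) = n → w' k = x ∧ w' (k + 1) = w (j + 1) := by
    intro k hk
    refine ⟨hw'n k hk, ?_⟩
    rw [hw'u _ (by rw [hsucc' k hk]; omega), hsucc' k hk]
    simp [hu]
  refine ⟨w', ⟨?_, ?_⟩, ?_, ⟨n - 1, hA _ (Nat.mod_eq_of_lt (by omega))⟩,
    ⟨n, hB _ (Nat.mod_eq_of_lt (by omega))⟩⟩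
  · intro a b
    rw [Nat.ModEq]
    by_cases ha : a % (n + 1) = n <;> by_cases hb : b % (n + 1) = n
    · simp [hw'n a ha, hw'n b hb, ha, hb]
    · rw [hw'n a ha, hw'u b hb]
      exact ⟨fun h => absurd h.symm (hux _), fun h => absurd (h.symm.trans ha) hb⟩
    · rw [hw'u a ha, hw'n b hb]
      exact ⟨fun h => absurd h (hux _), fun h => absurd (h.trans hb) ha⟩
    · rw [hw'u a ha, hw'u b hb]
      have h1 := hlt a
      have h2 := hlt b
      exact ⟨fun h => hs.injOn_lt (by omega) (by omega) h, fun h => by rw [h]⟩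
  · intro y
    rw [Finset.mem_insert]
    constructor
    · rintro (rfl | hy)
      · exact ⟨n, hw'n n (Nat.mod_eq_of_lt (by omega))⟩
      · obtain ⟨k, rfl⟩ := (hs.mem_iff y).1 hy
        have hk : k % n < n := Nat.mod_lt _ hn
        have hk' : k % n % (n + 1) = k % n := Nat.mod_eq_of_lt (by omega)
        exact ⟨k % n, by rw [hw'u _ (by omega), hk', hs.apply_mod]⟩
    · rintro ⟨k, rfl⟩
      by_cases hk : k % (n + 1) = n
      · exact Or.inl (hw'n k hk)
      · exact Or.inr (hw'u k hk ▸ hs.mem _)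
  · intro k
    by_cases hk : k % (n + 1) = n
    · exact Or.inr (Or.inr (hB k hk))
    by_cases hk1 : k % (n + 1) = n - 1
    · exact Or.inr (Or.inl (hA k hk1))
    · refine Or.inl ⟨k % (n + 1) + (j + 1), hw'u k hk, ?_⟩
      have := hlt k
      rw [hw'u _ (by rw [hsucc k hk]; omega), hsucc k hk]
      exact congrArg w (by omega)

end IsCyclicEnum

/-- Three elements can be listed cyclically. -/
theorem exists_isCyclicEnum_three {V : Type*} {S : Finset V} (hS : S.card = 3) :
    ∃ w, IsCyclicEnum S 3 w := by
  classical
  let e := S.equivFinOfCardEq hS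
  refine ⟨fun k => (e.symm ⟨k % 3, Nat.mod_lt _ (by norm_num)⟩ : V), fun a b => ?_, fun y => ?_⟩
  · rw [Subtype.coe_inj, e.symm.injective.eq_iff, Fin.mk.injEq, Nat.ModEq]
  · constructor
    · intro hy
      refine ⟨(e ⟨y, hy⟩).val, ?_⟩
      simp [Nat.mod_eq_of_lt (e ⟨y, hy⟩).isLt]
    · rintro ⟨k, rfl⟩
      exact Subtype.coe_prop _

/-! ### Cyclic orders avoiding a sparse graph -/

namespace SimpleGraph

variable {V : Type*} [DecidableEq V] (B : SimpleGraph V) [DecidableRel B.Adj]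

theorem filter_adj_erase_self (S : Finset V) (x : V) :
    (S.erase x).filter (B.Adj x) = S.filter (B.Adj x) := by
  rw [Finset.filter_erase, Finset.erase_eq_of_notMem (by simp)]

theorem sum_card_filter_adj_erase {S : Finset V} {x : V} (hx : x ∈ S) :
    ∑ y ∈ S, (S.filter (B.Adj y)).card =
      ∑ y ∈ S.erase x, ((S.erase x).filter (B.Adj y)).card + 2 * (S.filter (B.Adj x)).card := by
  rw [← Finset.add_sum_erase _ _ hx]
  have h : ∀ y ∈ S.erase x, (S.filter (B.Adj y)).card =
      ((S.erase x).filter (B.Adj y)).card + if B.Adj x y then 1 else 0 := by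
    intro y _
    rw [Finset.filter_erase]
    by_cases hxy : B.Adj x y
    · rw [if_pos hxy, Finset.card_erase_add_one (by simp [hx, hxy.symm])]
    · rw [if_neg hxy, Finset.erase_eq_of_notMem (by simp [B.adj_comm y x, hxy]), add_zero]
  rw [Finset.sum_congr rfl h, Finset.sum_add_distrib, ← Finset.card_filter,
    B.filter_adj_erase_self]
  ring

/-- If few pairs are adjacent in `B`, the elements of `S` can be listed cyclically such that
consecutive elements are never adjacent in `B`. -/
theorem exists_isCyclicEnum_not_adj {n : ℕ} (hn : 3 ≤ n) {S : Finset V} (hS : S.card = n)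
    (hB : ∑ y ∈ S, (S.filter (B.Adj y)).card + 6 ≤ 2 * n) :
    ∃ w, IsCyclicEnum S n w ∧ ∀ k, ¬ B.Adj (w k) (w (k + 1)) := by
  induction n, hn using Nat.le_induction generalizing S with
  | base =>
    obtain ⟨w, hw⟩ := exists_isCyclicEnum_three hS
    refine ⟨w, hw, fun k hk => ?_⟩
    have h0 : ∑ y ∈ S, (S.filter (B.Adj y)).card = 0 := by omega
    rw [Finset.sum_eq_zero_iff] at h0
    have h1 := h0 _ (hw.mem k)
    rw [Finset.card_eq_zero, Finset.filter_eq_empty_iff] at h1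
    exact h1 (hw.mem _) hk
  | succ n hn ih =>
    -- If `B` has an edge in `S`, take its endpoint of smaller degree. Removing it loses an edge,
    -- and the two degrees sum to at most one more than the number of edges, which is at most `n -
    -- 2`.
    obtain ⟨x, hx, hd, hB'⟩ : ∃ x ∈ S, 2 * (S.filter (B.Adj x)).card < n ∧
        ∑ y ∈ S.erase x, ((S.erase x).filter (B.Adj y)).card + 6 ≤ 2 * n := by
      by_cases hE : ∃ x ∈ S, ∃ y ∈ S, B.Adj x y
      · obtain ⟨x, hx, y, hy, hxy⟩ := hE
        have hx1 := B.sum_card_filter_adj_erase hx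
        have hy1 := B.sum_card_filter_adj_erase hy
        have hyx : y ∈ S.erase x := Finset.mem_erase.2 ⟨hxy.ne', hy⟩
        have hxy1 := B.sum_card_filter_adj_erase hyx
        have hdy : (S.filter (B.Adj y)).card ≤ ((S.erase x).filter (B.Adj y)).card + 1 := by
          rw [Finset.filter_erase]
          exact Nat.sub_le_iff_le_add.1 Finset.pred_card_le_card_erase
        have hposx : 0 < (S.filter (B.Adj x)).card :=
          Finset.card_pos.2 ⟨y, by simp [hy, hxy]⟩
        have hposy : 0 < (S.filter (B.Adj y)).card :=
          Finset.card_pos.2 ⟨x, by simp [hx, hxy.symm]⟩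
        by_cases hle : (S.filter (B.Adj x)).card ≤ (S.filter (B.Adj y)).card
        · exact ⟨x, hx, by omega, by omega⟩
        · exact ⟨y, hy, by omega, by omega⟩
      · push Not at hE
        have hz : ∀ x ∈ S, (S.filter (B.Adj x)).card = 0 := fun x hx => by
          rw [Finset.card_eq_zero, Finset.filter_eq_empty_iff]
          exact fun y hy => hE x hx y hy
        obtain ⟨x, hx⟩ : S.Nonempty := Finset.card_pos.1 (by omega)
        have h1 := B.sum_card_filter_adj_erase hx
        rw [Finset.sum_eq_zero hz] at h1
        exact ⟨x, hx, by rw [hz x hx]; omega, by omega⟩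
    obtain ⟨w, hw, hwB⟩ := ih (S := S.erase x) (by rw [Finset.card_erase_of_mem hx]; omega) hB'
    -- Fewer than half of the listed elements are adjacent to `x`, so two consecutive ones are not.
    obtain ⟨j, hj⟩ := hw.exists_consecutive_lt (by omega)
      (fun y => if B.Adj x y then 1 else 0) (t := 1) (by
        rw [← Finset.card_filter, B.filter_adj_erase_self]
        omega)
    have hj1 : ¬ B.Adj x (w j) := fun h => by simp [h] at hj
    have hj2 : ¬ B.Adj x (w (j + 1)) := fun h => by simp [h] at hj
    obtain ⟨w', hw', hcases, -, -⟩ := hw.exists_insert (by omega) (Finset.notMem_erase x S) j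
    rw [Finset.insert_erase hx] at hw'
    refine ⟨w', hw', fun k => ?_⟩
    rcases hcases k with ⟨i, h1, h2⟩ | ⟨h1, h2⟩ | ⟨h1, h2⟩ <;> rw [h1, h2]
    · exact hwB i
    · rwa [B.adj_comm]
    · exact hj2

end SimpleGraph

/-! ### List coloring of a cycle -/

/-- Colors can be chosen greedily along a path when every list but the first has two colors. -/
theorem exists_greedy_coloring {α : Type*} [DecidableEq α] (L : ℕ → Finset α) (a : α) (K : ℕ)
    (hL : ∀ k < K, 2 ≤ (L (k + 1)).card) :
    ∃ f : ℕ → α, f 0 = a ∧ ∀ k < K, f (k + 1) ∈ L (k + 1) ∧ f (k + 1) ≠ f k := by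
  induction K with
  | zero => exact ⟨fun _ => a, rfl, fun k hk => absurd hk (Nat.not_lt_zero k)⟩
  | succ K ih =>
    obtain ⟨f, hf0, hf⟩ := ih fun k hk => hL k (by omega)
    obtain ⟨z, hz, hzne⟩ := Finset.exists_mem_ne (hL K (by omega)) (f K)
    refine ⟨Function.update f (K + 1) z, by simpa using hf0, fun k hk => ?_⟩
    rcases Nat.lt_succ_iff_lt_or_eq.1 hk with hlt | rfl
    · rw [Function.update_of_ne (by omega), Function.update_of_ne (by omega)]
      exact hf k hlt
    · rw [Function.update_self, Function.update_of_ne (by omega)]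
      exact ⟨hz, hzne⟩

/-- The edges of a cycle can be properly colored from lists, one of which has a color, another
three colors, and the rest two colors each. -/
theorem exists_cyclic_list_coloring {α : Type*} [DecidableEq α] (L : ℕ → Finset α) {N j : ℕ}
    (hj0 : 0 < j) (hjN : j < N) (h0 : (L 0).Nonempty) (h3 : 3 ≤ (L j).card)
    (h2 : ∀ k, 0 < k → k < N → 2 ≤ (L k).card) :
    ∃ f : ℕ → α, (∀ k < N, f k ∈ L k) ∧ (∀ k, k + 1 < N → f k ≠ f (k + 1)) ∧
      f (N - 1) ≠ f 0 := by
  obtain ⟨a, ha⟩ := h0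
  obtain ⟨f, hf0, hf⟩ := exists_greedy_coloring L a (j - 1) fun k hk => h2 _ (by omega) (by omega)
  -- `g` runs backwards from position `N`, which stands for position `0`, hence the same first color
  -- `a`. The two colorings meet at `j`, where three colors suffice against two neighbors.
  obtain ⟨g, hg0, hg⟩ := exists_greedy_coloring (fun k => L (N - k)) a (N - 1 - j)
    fun k hk => h2 _ (by omega) (by omega)
  obtain ⟨z, hz, hzn⟩ : ∃ z ∈ L j, z ∉ ({f (j - 1), g (N - 1 - j)} : Finset α) :=
    Finset.exists_mem_notMem_of_card_lt_card (lt_of_le_of_lt Finset.card_le_two (by omega))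
  simp only [Finset.mem_insert, Finset.mem_singleton, not_or] at hzn
  have hg' : ∀ k, j < k → k < N → g (N - k) ∈ L k ∧ g (N - k) ≠ g (N - k - 1) := by
    intro k h1 h2
    have := hg (N - k - 1) (by omega)
    rwa [show N - k - 1 + 1 = N - k by omega, show N - (N - k) = k by omega] at this
  refine ⟨fun k => if k < j then f k else if k = j then z else g (N - k), ?_, ?_, ?_⟩
  · intro k hk
    dsimp only
    split_ifs with h1 h2
    · rcases Nat.eq_zero_or_pos k with rfl | hpos
      · rwa [hf0]
      · have := (hf (k - 1) (by omega)).1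
        rwa [show k - 1 + 1 = k by omega] at this
    · rwa [h2]
    · exact (hg' k (by omega) hk).1
  · intro k hk
    dsimp only
    rcases lt_trichotomy (k + 1) j with h | h | h
    · rw [if_pos (by omega), if_pos h]
      exact (hf k (by omega)).2.symm
    · rw [if_pos (by omega), if_neg (by omega), if_pos h, show k = j - 1 by omega]
      exact Ne.symm hzn.1
    · rw [if_neg (by omega), if_neg (by omega : ¬ k + 1 < j), if_neg (by omega : ¬ k + 1 = j)]
      have h4 : N - (k + 1) = N - k - 1 := by omega
      split_ifs with h5
      · rw [h5, show N - (j + 1) = N - 1 - j by omega]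
        exact hzn.2
      · rw [h4]
        exact (hg' k (by omega) (by omega)).2
  · dsimp only
    rw [if_pos hj0, if_neg (by omega), hf0]
    split_ifs with h5
    · have := hzn.2
      rwa [← h5, Nat.sub_self, hg0] at this
    · have := (hg' (N - 1) (by omega) (by omega)).2
      rwa [show N - (N - 1) - 1 = 0 by omega, hg0] at this


namespace IsCyclicEnum

variable {V : Type*} {S : Finset V} {n : ℕ} {w : ℕ → V}

theorem apply_ne_succ (h : IsCyclicEnum S n w) (hn : 2 ≤ n) (k : ℕ) : w k ≠ w (k + 1) := by
  rw [Ne, h.eq_iff, Nat.ModEq.comm]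
  intro hk
  have := (Nat.modEq_iff_dvd' (by omega)).1 hk.symm
  rw [Nat.add_sub_cancel_left] at this
  have := Nat.le_of_dvd one_pos this
  omega

/-- A match with reversed endpoints would force `b + 2 ≡ b`, impossible for `n ≥ 3`. -/
theorem mk_eq_iff (h : IsCyclicEnum S n w) (hn : 3 ≤ n) (a b : ℕ) :
    s(w a, w (a + 1)) = s(w b, w (b + 1)) ↔ a ≡ b [MOD n] := by
  rw [Sym2.eq_iff, h.eq_iff, h.eq_iff, h.eq_iff, h.eq_iff]
  constructor
  · rintro (h1 | ⟨h1, h2⟩)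
    · exact h1.1
    · have h3 : b + 2 ≡ b [MOD n] := ((h1.add_right 1).symm.trans h2)
      have h4 := (Nat.modEq_iff_dvd' (by omega)).1 h3.symm
      rw [Nat.add_sub_cancel_left] at h4
      have := Nat.le_of_dvd two_pos h4
      omega
  · exact fun h1 => Or.inl ⟨h1, h1.add_right 1⟩

theorem card_image_mk [DecidableEq V] (h : IsCyclicEnum S n w) (hn : 3 ≤ n) :
    ((Finset.range n).image fun k => s(w k, w (k + 1))).card = n := by
  rw [Finset.card_image_of_injOn, Finset.card_range]
  intro a ha b hb hab
  have := (h.mk_eq_iff hn a b).1 hab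
  rwa [Nat.ModEq, Nat.mod_eq_of_lt (by simpa using ha),
    Nat.mod_eq_of_lt (by simpa using hb)] at this

end IsCyclicEnum

/-- If few pairs are forbidden, the elements of `S` can be listed cyclically such that no two
consecutive elements form a forbidden pair. -/
theorem exists_isCyclicEnum_notMem {V : Type*} [Fintype V] (B : Finset (Sym2 V)) {S : Finset V}
    {n : ℕ} (hn : 3 ≤ n) (hS : S.card = n) (hB : B.card + 3 ≤ n) :
    ∃ w, IsCyclicEnum S n w ∧ ∀ k, s(w k, w (k + 1)) ∉ B := by
  classical
  obtain ⟨H, hH⟩ : ∃ H, H = SimpleGraph.fromEdgeSet (B : Set (Sym2 V)) := ⟨_, rfl⟩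
  have hdeg : ∑ y ∈ S, (S.filter (H.Adj y)).card ≤ ∑ y, H.degree y := by
    refine (Finset.sum_le_sum fun y _ => ?_).trans
      (Finset.sum_le_sum_of_subset (Finset.subset_univ S))
    rw [← SimpleGraph.card_neighborFinset_eq_degree]
    refine Finset.card_le_card fun z hz => ?_
    simpa using (Finset.mem_filter.1 hz).2
  rw [H.sum_degrees_eq_twice_card_edges] at hdeg
  have hdegB := hdeg.trans (Nat.mul_le_mul_left 2 (Finset.card_le_card (t := B) fun e he => by
    rw [SimpleGraph.mem_edgeFinset, hH, SimpleGraph.edgeSet_fromEdgeSet] at he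
    exact he.1))
  obtain ⟨w, hw, hwB⟩ := H.exists_isCyclicEnum_not_adj hn hS (by omega)
  exact ⟨w, hw, fun k hk => hwB k
    (hH ▸ (SimpleGraph.fromEdgeSet_adj _).2 ⟨hk, hw.apply_ne_succ (by omega) k⟩)⟩

/-- Each pair is counted from both of its ends; this serves the averaging over vertices. -/
theorem Sym2.sum_sum_erase_mk {V : Type*} [Fintype V] [DecidableEq V] (f : Sym2 V → ℕ) :
    ∑ x, ∑ y ∈ Finset.univ.erase x, f s(x, y) =
      2 * ∑ e ∈ (⊤ : SimpleGraph V).edgeFinset, f e := by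
  have h1 : ∀ x, ∑ y ∈ Finset.univ.erase x, f s(x, y) =
      ∑ e ∈ (⊤ : SimpleGraph V).edgeFinset with x ∈ e, f e := by
    intro x
    refine Finset.sum_bij (fun y _ => s(x, y)) ?_ ?_ ?_ (fun _ _ => rfl)
    · intro y hy
      simpa [eq_comm] using hy
    · intro a _ b _ hab
      exact Sym2.congr_right.1 hab
    · intro e he
      rw [Finset.mem_filter] at he
      obtain ⟨y, rfl⟩ := Sym2.mem_iff_exists.1 he.2
      exact ⟨y, by simpa [eq_comm] using he.1, rfl⟩
  simp_rw [h1, Finset.sum_filter]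
  rw [Finset.sum_comm, Finset.mul_sum]
  refine Finset.sum_congr rfl fun e he => ?_
  rw [← Finset.sum_filter, Finset.sum_const, smul_eq_mul]
  congr 1
  rw [SimpleGraph.mem_edgeFinset, SimpleGraph.edgeSet_top] at he
  rw [← Sym2.card_toFinset_of_not_isDiag e (by simpa using he)]
  congr 1
  ext v
  simp

/-! ### Missing colors and the sufficient condition -/

namespace ColoredMultigraph

variable {V : Type*} {c : ℕ} (G : ColoredMultigraph V c)

open Classical in
/-- The colors of the edges with given endpoints. -/
noncomputable def colors (e : Sym2 V) : Finset (Fin c) :=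
  Finset.univ.filter fun a => (e, a) ∈ G.edges

theorem mem_colors {e : Sym2 V} {a : Fin c} : a ∈ G.colors e ↔ (e, a) ∈ G.edges := by
  simp [colors]

/-- The number of colors not used between given endpoints. -/
noncomputable def missing (e : Sym2 V) : ℕ := c - (G.colors e).card

theorem card_colors_add_missing (e : Sym2 V) : (G.colors e).card + G.missing e = c :=
  Nat.add_sub_cancel' (by simpa using Finset.card_le_univ (G.colors e))

theorem sum_card_colors [Fintype V] [DecidableEq V] :
    ∑ e ∈ (⊤ : SimpleGraph V).edgeFinset, (G.colors e).card = G.numEdges := by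
  rw [numEdges, Finset.card_eq_sum_card_fiberwise (f := Prod.fst)
    (t := (⊤ : SimpleGraph V).edgeFinset)]
  · refine Finset.sum_congr rfl fun e _ => ?_
    refine Finset.card_bij (fun a _ => (e, a)) ?_ ?_ ?_
    · intro a ha
      simpa using G.mem_colors.1 ha
    · intro a _ b _ hab
      exact (Prod.ext_iff.1 hab).2
    · rintro ⟨e', a⟩ h
      rw [Finset.mem_filter] at h
      obtain ⟨h1, rfl⟩ := h
      exact ⟨a, G.mem_colors.2 h1, rfl⟩
  · intro e he
    simpa using G.loopless e he

theorem sum_missing_add_numEdges [Fintype V] [DecidableEq V] :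
    ∑ e ∈ (⊤ : SimpleGraph V).edgeFinset, G.missing e + G.numEdges =
      c * (Fintype.card V).choose 2 := by
  rw [← G.sum_card_colors, ← Finset.sum_add_distrib,
    ← SimpleGraph.card_edgeFinset_top_eq_card_choose_two, mul_comm c]
  exact Finset.sum_const_nat fun e _ => by rw [add_comm, card_colors_add_missing]

/-- A cyclic order of the vertices, in which all consecutive pairs have two colors, except that
one of them may have a single color, and some pair has three colors, gives a proper Hamiltonian
cycle. -/
theorem hasProperHamiltonianCycle_of_isCyclicEnum [Fintype V] {N : ℕ} (hN : 3 ≤ N) {w : ℕ → V}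
    (hw : IsCyclicEnum Finset.univ N w) (e₀ : Sym2 V)
    (h1 : ∀ k, (G.colors s(w k, w (k + 1))).Nonempty)
    (h2 : ∀ k, s(w k, w (k + 1)) ≠ e₀ → 2 ≤ (G.colors s(w k, w (k + 1))).card)
    (h3 : ∃ j, 3 ≤ (G.colors s(w j, w (j + 1))).card) : G.HasProperHamiltonianCycle := by
  obtain ⟨j, hj⟩ := h3
  obtain ⟨i, hij, hi⟩ : ∃ i, ¬ j ≡ i [MOD N] ∧
      ∀ k, ¬ k ≡ i [MOD N] → 2 ≤ (G.colors s(w k, w (k + 1))).card := by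
    by_cases h : ∃ i, s(w i, w (i + 1)) = e₀ ∧ ¬ j ≡ i [MOD N]
    · obtain ⟨i, rfl, hij⟩ := h
      exact ⟨i, hij, fun k hk => h2 k fun h => hk ((hw.mk_eq_iff hN k i).1 h)⟩
    · push Not at h
      -- Here `e₀` occurs at most at `j`, where there are three colors, so any other position may
      -- serve as `i`.
      refine ⟨j + 1, fun h => hw.apply_ne_succ (by omega) j ((hw.eq_iff _ _).2 h), fun k _ => ?_⟩
      by_cases hk : s(w k, w (k + 1)) = e₀
      · rw [← (hw.mk_eq_iff hN j k).2 (h k hk)]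
        omega
      · exact h2 k hk
  have hs := hw.shift (by omega) i
  obtain ⟨m, hm⟩ : ∃ m, w (m + i) = w j := by
    simpa using (hs.mem_iff (w j)).1 (Finset.mem_univ _)
  rw [hw.eq_iff] at hm
  have hmN : m % N + i ≡ j [MOD N] := ((Nat.mod_modEq m N).add_right i).trans hm
  obtain ⟨f, hf, hne, hlast⟩ := exists_cyclic_list_coloring
    (fun k => G.colors s(w (k + i), w (k + i + 1))) (N := N) (j := m % N)
    (Nat.pos_of_ne_zero fun h => hij (by rw [h, zero_add] at hmN; exact hmN.symm))
    (Nat.mod_lt _ (by omega)) (h1 _)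
    (by rw [(hw.mk_eq_iff hN _ _).2 hmN]; exact hj)
    (fun k hk0 hkN => hi _ fun h => by
      have h' : k + i ≡ 0 + i [MOD N] := by rwa [zero_add]
      have := Nat.ModEq.add_right_cancel' i h'
      rw [Nat.ModEq, Nat.mod_eq_of_lt hkN, Nat.zero_mod] at this
      omega)
  have : NeZero N := ⟨by omega⟩
  have : Fact (1 < N) := ⟨by omega⟩
  have hval : ∀ a : ZMod N, (a + 1).val = (a.val + 1) % N := fun a => by
    rw [ZMod.val_add, ZMod.val_one]
  refine ⟨N, fun a => w (a.val + i), fun a => f a.val, ⟨hN, ?_, ?_, ?_⟩, ?_⟩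
  · intro a b hab
    exact ZMod.val_injective N (hs.injOn_lt (ZMod.val_lt a) (ZMod.val_lt b) hab)
  · intro a
    have h := hs.apply_mod (a.val + 1)
    rw [hval, h, add_right_comm]
    exact G.mem_colors.1 (hf _ (ZMod.val_lt a))
  · intro a
    rw [hval]
    have ha := ZMod.val_lt a
    rcases Nat.lt_or_ge (a.val + 1) N with h | h
    · rw [Nat.mod_eq_of_lt h]
      exact hne _ h
    · have h' : a.val + 1 = N := by omega
      rw [h', Nat.mod_self, show a.val = N - 1 by omega]
      exact hlast
  · intro y
    obtain ⟨k, hk⟩ := (hs.mem_iff y).1 (Finset.mem_univ _)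
    refine ⟨(k : ZMod N), ?_⟩
    have h := hs.apply_mod k
    change w ((k : ZMod N).val + i) = y
    rw [ZMod.val_natCast, h, hk]

/-- A lower bound for the number of missing edges forces a pair with three colors in `T`. -/
theorem exists_three_le_card_colors [Fintype V] [DecidableEq V] {B T : Finset (Sym2 V)}
    (hB : B ⊆ (⊤ : SimpleGraph V).edgeFinset) (hT : T ⊆ (⊤ : SimpleGraph V).edgeFinset)
    (hBT : Disjoint B T) (hB1 : ∀ e ∈ B, (G.colors e).card ≤ 1)
    (h : ∑ e ∈ (⊤ : SimpleGraph V).edgeFinset, G.missing e <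
      B.card * (c - 1) + T.card * (c - 2)) :
    ∃ e ∈ T, 3 ≤ (G.colors e).card := by
  by_contra! hcon
  have h1 : B.card * (c - 1) ≤ ∑ e ∈ B, G.missing e :=
    Finset.card_nsmul_le_sum _ _ _ fun e he => by
      have := hB1 e he
      simp only [missing]
      omega
  have h2 : T.card * (c - 2) ≤ ∑ e ∈ T, G.missing e :=
    Finset.card_nsmul_le_sum _ _ _ fun e he => by
      have := hcon e he
      simp only [missing]
      omega
  have h3 : ∑ e ∈ B ∪ T, G.missing e ≤ ∑ e ∈ (⊤ : SimpleGraph V).edgeFinset, G.missing e :=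
    Finset.sum_le_sum_of_subset (Finset.union_subset hB hT)
  rw [Finset.sum_union hBT] at h3
  omega

theorem hasProperHamiltonianCycle_of_sum_missing [Fintype V] [DecidableEq V]
    (hV : 4 ≤ Fintype.card V) (hc : 3 ≤ c) (hcV : c < Fintype.card V)
    (hsum : ∑ e ∈ (⊤ : SimpleGraph V).edgeFinset, G.missing e + Fintype.card V ≤
      c * (Fintype.card V - 1)) : G.HasProperHamiltonianCycle := by
  set N := Fintype.card V with hN
  set P := (⊤ : SimpleGraph V).edgeFinset with hP
  set B := P.filter fun e => (G.colors e).card ≤ 1 with hBdef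
  have hBP : B ⊆ P := Finset.filter_subset _ _
  have hB1 : ∀ e ∈ B, (G.colors e).card ≤ 1 := fun e he => (Finset.mem_filter.1 he).2
  have hPB : ∀ {x y : V}, x ≠ y → s(x, y) ∉ B → 2 ≤ (G.colors s(x, y)).card := by
    intro x y hxy h
    by_contra hlt
    exact h (Finset.mem_filter.2 ⟨by simpa [hP] using hxy, by omega⟩)
  have hBsum : B.card * (c - 1) ≤ ∑ e ∈ P, G.missing e :=
    le_trans (Finset.card_nsmul_le_sum _ _ _ fun e he => by
      have := hB1 e he
      simp only [missing]
      omega) (Finset.sum_le_sum_of_subset hBP)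
  have hBsum' : (∀ e ∈ B, ¬ (G.colors e).card = 1) → B.card * c ≤ ∑ e ∈ P, G.missing e :=
    fun h0 => le_trans (Finset.card_nsmul_le_sum _ _ _ fun e he => by
      have := hB1 e he
      have := h0 e he
      simp only [missing]
      omega) (Finset.sum_le_sum_of_subset hBP)
  have hedges : ∀ {w : ℕ → V}, IsCyclicEnum Finset.univ N w →
      ((Finset.range N).image fun k => s(w k, w (k + 1))) ⊆ P := by
    intro w hw e he
    obtain ⟨k, -, rfl⟩ := Finset.mem_image.1 he
    simpa [hP] using hw.apply_ne_succ (by omega) k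
  obtain ⟨d, hd⟩ : ∃ d, c = d + 3 := ⟨c - 3, by omega⟩
  obtain ⟨m, hm⟩ : ∃ m, N = m + 4 := ⟨N - 4, by omega⟩
  rw [show c - 1 = d + 2 by omega] at hBsum
  have hcN : c * (N - 1) = (d + 3) * (m + 3) := by rw [hd, hm, show m + 4 - 1 = m + 3 by omega]
  rw [hcN, hm] at hsum
  have hBN : B.card ≤ m + 2 := by
    -- `(N-1)(c-1) = c(N-1) - (N-1)` already exceeds the allowed total by one.
    by_contra! hlt
    have : (m + 3) * (d + 2) ≤ B.card * (d + 2) := Nat.mul_le_mul_right _ hlt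
    nlinarith
  rcases Nat.lt_or_ge B.card (m + 1) with hlt | hge
  -- A vertex at which at most the average number of colors is missing.
  · obtain ⟨x, hx⟩ : ∃ x, N * ∑ y ∈ Finset.univ.erase x, G.missing s(x, y) ≤
        2 * ∑ e ∈ P, G.missing e := by
      by_contra! hcon
      have h1 : ∑ _x : V, 2 * ∑ e ∈ P, G.missing e <
          ∑ x, N * ∑ y ∈ Finset.univ.erase x, G.missing s(x, y) :=
        Finset.sum_lt_sum_of_nonempty
          (Finset.univ_nonempty_iff.2 (Fintype.card_pos_iff.1 (by omega))) fun x _ => hcon x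
      rw [← Finset.mul_sum, ← Finset.mul_sum, Sym2.sum_sum_erase_mk G.missing, Finset.sum_const, Finset.card_univ,
        smul_eq_mul, mul_left_comm] at h1
      exact lt_irrefl _ h1
    obtain ⟨w, hw, hwB⟩ := exists_isCyclicEnum_notMem B (S := Finset.univ.erase x) (n := m + 3)
      (by omega) (by rw [Finset.card_erase_of_mem (Finset.mem_univ x), Finset.card_univ]; omega)
      (by omega)
    -- The threshold is `c - 1`: a sum below it leaves two colors on both new pairs. The averaging
    -- reaches it because `N ≥ 4`.
    obtain ⟨j, hj⟩ := hw.exists_consecutive_lt (by omega) (fun y => G.missing s(x, y))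
      (t := d + 2) (by
        rw [hm] at hx
        by_contra! hle
        have h1 := Nat.mul_le_mul_left (m + 4) hle
        have h2 := Nat.mul_le_mul_right ((m + 3) * (d + 2)) (show 4 ≤ m + 4 by omega)
        linarith)
    have hj1 := G.card_colors_add_missing s(x, w j)
    have hj2 := G.card_colors_add_missing s(x, w (j + 1))
    obtain ⟨w', hw', hcases, ⟨k₁, hk₁, hk₁'⟩, ⟨k₂, hk₂, hk₂'⟩⟩ :=
      hw.exists_insert (by omega) (Finset.notMem_erase x _) j
    rw [Finset.insert_erase (Finset.mem_univ x), show m + 3 + 1 = N by omega] at hw'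
    have htwo : ∀ k, 2 ≤ (G.colors s(w' k, w' (k + 1))).card := by
      intro k
      rcases hcases k with ⟨i, h1, h2⟩ | ⟨h1, h2⟩ | ⟨h1, h2⟩ <;> rw [h1, h2]
      · exact hPB (hw.apply_ne_succ (by omega) i) (hwB i)
      · rw [Sym2.eq_swap]
        omega
      · omega
    refine G.hasProperHamiltonianCycle_of_isCyclicEnum (by omega) hw' s(x, x)
      (fun k => Finset.card_pos.1 (by have := htwo k; omega)) (fun k _ => htwo k) ?_
    -- If the first new pair misses `c - 2` colors or more, the second misses none.
    by_cases h : 3 ≤ (G.colors s(x, w j)).card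
    · exact ⟨k₁, by rwa [hk₁, hk₁', Sym2.eq_swap]⟩
    · exact ⟨k₂, by rw [hk₂, hk₂']; omega⟩
  -- `e₀` is the bad pair to tolerate; with only `N - 3` bad pairs a loop is the dummy value, as it
  -- never lies on the cycle.
  · obtain ⟨e₀, he₀, hcard⟩ : ∃ e₀, (e₀ ∈ B → (G.colors e₀).card = 1) ∧
        (B.erase e₀).card ≤ m + 1 ∧ (B.card = m + 2 ∨ e₀ ∉ P) := by
      rcases Nat.lt_or_ge B.card (m + 2) with h | h
      · obtain ⟨x⟩ : Nonempty V := Fintype.card_pos_iff.1 (by omega)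
        have hx : s(x, x) ∉ P := by simp [hP]
        exact ⟨s(x, x), fun h => absurd (hBP h) hx,
          (Finset.card_le_card (Finset.erase_subset _ _)).trans (by omega), Or.inr hx⟩
      -- Otherwise `c(N-2)` colors are missing, more than `c(N-1) - N` because `c < N`.
      · obtain ⟨e₀, he₀, h1⟩ : ∃ e ∈ B, (G.colors e).card = 1 := by
          by_contra! hcon
          have h2 := hBsum' hcon
          rw [show B.card = m + 2 by omega] at h2
          have h3 : (m + 2) * c = (m + 2) * (d + 3) := by rw [hd]
          nlinarith
        exact ⟨e₀, fun _ => h1, by rw [Finset.card_erase_of_mem he₀]; omega, Or.inl (by omega)⟩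
    obtain ⟨w, hw, hwB⟩ := exists_isCyclicEnum_notMem (B.erase e₀) (S := Finset.univ) (n := N)
      (by omega) (by rw [Finset.card_univ]) (by omega)
    have htwo : ∀ k, s(w k, w (k + 1)) ≠ e₀ → 2 ≤ (G.colors s(w k, w (k + 1))).card :=
      fun k hk => hPB (hw.apply_ne_succ (by omega) k) fun h =>
        hwB k (Finset.mem_erase.2 ⟨hk, h⟩)
    refine G.hasProperHamiltonianCycle_of_isCyclicEnum (by omega) hw e₀ (fun k => ?_) htwo ?_
    · refine Finset.card_pos.1 ?_
      by_cases hk : s(w k, w (k + 1)) ∈ B ∧ s(w k, w (k + 1)) = e₀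
      · rw [hk.2, he₀ (hk.2 ▸ hk.1)]
        exact one_pos
      · by_cases hk' : s(w k, w (k + 1)) ∈ B
        · exact absurd (Finset.mem_erase.2 ⟨fun h => hk ⟨hk', h⟩, hk'⟩) (hwB k)
        · have := hPB (hw.apply_ne_succ (by omega) k) hk'
          omega
    · set C := (Finset.range N).image fun k => s(w k, w (k + 1)) with hC
      have hCN : C.card = N := hw.card_image_mk (by omega)
      obtain ⟨_, he, h3⟩ := G.exists_three_le_card_colors (B := B) (T := C.erase e₀) hBP
        ((Finset.erase_subset _ _).trans (hedges hw))
        (Finset.disjoint_left.2 fun _ he he' => by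
          obtain ⟨hne, he'⟩ := Finset.mem_erase.1 he'
          obtain ⟨k, -, rfl⟩ := Finset.mem_image.1 he'
          exact hwB k (Finset.mem_erase.2 ⟨hne, he⟩)) hB1 (by
          rw [show c - 1 = d + 2 by omega, show c - 2 = d + 1 by omega]
          change ∑ e ∈ P, G.missing e < _
          rcases hcard.2 with h | h
          · have hT : m + 3 ≤ (C.erase e₀).card := by
              have := Finset.pred_card_le_card_erase (s := C) (a := e₀)
              omega
            rw [h]
            nlinarith [Nat.mul_le_mul_right (d + 1) hT]
          · rw [Finset.erase_eq_of_notMem fun h' => h (hedges hw h'), hCN, hm]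
            nlinarith [Nat.mul_le_mul_right (d + 2) hge])
      obtain ⟨-, he⟩ := Finset.mem_erase.1 he
      obtain ⟨k, -, rfl⟩ := Finset.mem_image.1 he
      exact ⟨k, h3⟩

/-! ### The extremal example -/

/-- All edges that avoid the vertex `0`, and all edges of color `0` at the vertex `0`. -/
def monochromaticStar (n c : ℕ) [NeZero n] [NeZero c] : ColoredMultigraph (Fin n) c where
  edges := Finset.univ.filter fun e => ¬ e.1.IsDiag ∧ ((0 : Fin n) ∈ e.1 → e.2 = 0)
  loopless _ he := (Finset.mem_filter.1 he).2.1

section monochromaticStar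

variable (n c : ℕ) [NeZero n] [NeZero c]

theorem mem_edges_monochromaticStar {e : Sym2 (Fin n)} {a : Fin c} :
    (e, a) ∈ (monochromaticStar n c).edges ↔ ¬ e.IsDiag ∧ ((0 : Fin n) ∈ e → a = 0) := by
  simp [monochromaticStar]

theorem connected_monochromaticStar : (monochromaticStar n c).Connected := by
  have h : ∀ x : Fin n, (monochromaticStar n c).underlying.Reachable 0 x := by
    intro x
    by_cases hx : 0 = x
    · rw [hx]
    · exact SimpleGraph.Adj.reachable ⟨0, (mem_edges_monochromaticStar n c).2 (by simpa using hx)⟩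
  exact ⟨fun x y => (h x).symm.trans (h y)⟩

theorem numEdges_monochromaticStar (hn : 1 ≤ n) :
    (monochromaticStar n c).numEdges = c * (n - 1).choose 2 + (n - 1) := by
  have hI : (((⊤ : SimpleGraph (Fin n)).edgeFinset).filter fun e => (0 : Fin n) ∈ e).card =
      n - 1 := by
    rw [← SimpleGraph.incidenceFinset_eq_filter, SimpleGraph.card_incidenceFinset_eq_degree,
      SimpleGraph.complete_graph_degree, Fintype.card_fin]
  have hT := SimpleGraph.card_edgeFinset_top_eq_card_choose_two (V := Fin n)
  rw [Fintype.card_fin] at hT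
  rw [← Finset.card_filter_add_card_filter_not (p := fun e => (0 : Fin n) ∈ e), hI] at hT
  obtain ⟨k, rfl⟩ : ∃ k, n = k + 1 := ⟨n - 1, by omega⟩
  rw [Nat.choose_succ_succ' k 1, Nat.choose_one_right, Nat.add_sub_cancel, Nat.add_left_cancel_iff]
    at hT
  rw [← sum_card_colors, ← Finset.sum_filter_add_sum_filter_not _ (fun e => (0 : Fin (k + 1)) ∈ e),
    add_comm]
  congr 1
  · rw [Nat.add_sub_cancel, ← hT, mul_comm]
    refine Finset.sum_const_nat fun e he => ?_
    rw [Finset.mem_filter, SimpleGraph.mem_edgeFinset, SimpleGraph.edgeSet_top] at he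
    have : (monochromaticStar (k + 1) c).colors e = Finset.univ := by
      ext a
      rw [mem_colors, mem_edges_monochromaticStar]
      simpa [he.2] using he.1
    rw [this, Finset.card_univ, Fintype.card_fin]
  · rw [← hI, Finset.card_eq_sum_ones]
    refine Finset.sum_congr rfl fun e he => ?_
    rw [Finset.mem_filter, SimpleGraph.mem_edgeFinset, SimpleGraph.edgeSet_top] at he
    have : (monochromaticStar (k + 1) c).colors e = {0} := by
      ext a
      have h1 : ¬ e.IsDiag := by simpa using he.1
      rw [mem_colors, mem_edges_monochromaticStar]
      simp [he.2, h1]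
    rw [this, Finset.card_singleton]

/-- The two cycle edges at the vertex `0` would both have color `0`. -/
theorem not_hasProperHamiltonianCycle_monochromaticStar :
    ¬ (monochromaticStar n c).HasProperHamiltonianCycle := by
  rintro ⟨k, v, col, hcyc, hsurj⟩
  obtain ⟨i, hi⟩ := hsurj 0
  have h1 := hcyc.mem_edges (i - 1)
  have h2 := hcyc.mem_edges i
  have h3 := hcyc.proper (i - 1)
  rw [sub_add_cancel] at h1 h3
  rw [mem_edges_monochromaticStar] at h1 h2
  exact h3 ((h1.2 (by simp [hi])).trans (h2.2 (by simp [hi])).symm)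

end monochromaticStar

end ColoredMultigraph

theorem theorem4 (n c : ℕ) (hn : 4 ≤ n) (hc : 3 ≤ c) (hcn : c < n) :
    (∀ (V : Type*) [Fintype V] (G : ColoredMultigraph V c), Fintype.card V = n →
      c * (n - 1).choose 2 + n ≤ G.numEdges → G.HasProperHamiltonianCycle) ∧
    (∃ G : ColoredMultigraph (Fin n) c, G.Connected ∧
      G.numEdges = c * (n - 1).choose 2 + (n - 1) ∧ ¬ G.HasProperHamiltonianCycle) := by
  constructor
  · intro V _ G hV hG
    classical
    refine G.hasProperHamiltonianCycle_of_sum_missing (by omega) hc (by omega) ?_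
    have h := G.sum_missing_add_numEdges
    -- By Pascal's rule, the total `c * n.choose 2` exceeds `c * (n - 1).choose 2` by `c * (n - 1)`.
    obtain ⟨k, rfl⟩ : ∃ k, n = k + 1 := ⟨n - 1, by omega⟩
    rw [hV, Nat.choose_succ_succ' k 1, Nat.choose_one_right, mul_add, one_add_one_eq_two] at h
    rw [Nat.add_sub_cancel] at hG
    rw [hV, Nat.add_sub_cancel]
    omega
  · have : NeZero n := ⟨by omega⟩
    have : NeZero c := ⟨by omega⟩
    exact ⟨ColoredMultigraph.monochromaticStar n c,
      ColoredMultigraph.connected_monochromaticStar n c,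
      ColoredMultigraph.numEdges_monochromaticStar n c (by omega),
      ColoredMultigraph.not_hasProperHamiltonianCycle_monochromaticStar n c⟩
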